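/- Let $M$ be a closed (compact, without boundary) connected smooth $n$-manifold with a smooth action of the torus $T^k=(S^1)^k$. For $x\in M$ let $\mathrm{ev}\colon T^k\to M$, $\mathrm{ev}(t)=tx$, be the orbit map at $x$. The action is called injective if $\mathrm{ev}_\#\colon \mathbb Z^k=\pi_1(T^k,1)\to\pi=\pi_1(M,x)$ is injective (this does not depend on $x$); the image of $\mathrm{ev}_\#$ is always central in $\pi$, so with $Q=\pi/\mathrm{ev}_\#(\mathbb Z^k)$ an injective action gives a central extension $$1\to\mathbb Z^k\to\pi\to Q\to 1.$$ The action is called injective-splitting if it is injective and there is a normal subgroup $Q'$ of finite index in $Q$ such that the induced extension $1\to\mathbb Z^k\to\pi'\to Q'\to 1$, where $\pi'\le\pi$ is the preimage of $Q'$, splits, that is, $\pi'=\mathbb Z^k\times Q'$. The action is called homologically injective if $\mathrm{ev}_*\colon H_1(T^k;\mathbb Z)\to H_1(M;\mathbb Z)$ is injective. Write $b_j=\operatorname{rank}H_j(M;\mathbb Z)$. Suppose that the $T^k$-action on $M$ is injective-splitting. Then, for every orbit map, $\mathrm{ev}_*\colon H_j(T^k;\mathbb Z)\to H_j(M;\mathbb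 Z)$ is injective for every $j\ge 0$, and the following hold. (i) $\binom{k}{j}\le b_j$ for every $j\ge 0$. In particular the Halperin–Carlsson inequality $2^k\le\sum_{j=0}^{n}b_j$ holds. (ii) The $T^k$-action is homologically injective. -/

import Mathlib

open scoped Manifold ContDiff

noncomputable section

namespace TorusAction

open CategoryTheory

/-- The torus `T^k = (S^1)^k`, with Mathlib's product topology, group and charted space
structures. -/
abbrev Torus (k : ℕ) : Type := Fin k → Circle

/-- The (boundaryless) model with corners of the torus: the `k`-fold product of `𝓡 1`. -/
abbrev torusModel (k : ℕ) :
    ModelWithCorners ℝ (Fin k → EuclideanSpace ℝ (Fin 1))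
      (ModelPi fun _ : Fin k => EuclideanSpace ℝ (Fin 1)) :=
  ModelWithCorners.pi fun _ : Fin k => 𝓡 1

section Homology

/-- Singular homology `H_j(X; ℤ)`. -/
abbrev homology (j : ℕ) (X : Type) [TopologicalSpace X] : ModuleCat.{0} ℤ :=
  ((AlgebraicTopology.singularHomologyFunctor (ModuleCat.{0} ℤ) j).obj
    (ModuleCat.of ℤ ℤ)).obj (TopCat.of X)

/-- The map induced on `H_j( · ; ℤ)` by a continuous map. -/
def homologyMap (j : ℕ) {X Y : Type} [TopologicalSpace X] [TopologicalSpace Y] (f : C(X, Y)) :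
    homology j X →ₗ[ℤ] homology j Y :=
  (((AlgebraicTopology.singularHomologyFunctor (ModuleCat.{0} ℤ) j).obj
    (ModuleCat.of ℤ ℤ)).map (TopCat.ofHom f)).hom

/-- The `j`-th Betti number `b_j = rank H_j(X; ℤ)`, as a cardinal: no convention is needed
for groups of infinite rank. -/
def betti (j : ℕ) (X : Type) [TopologicalSpace X] : Cardinal.{0} :=
  Module.rank ℤ (homology j X)

end Homology

section Action

variable (k : ℕ) {M : Type} [TopologicalSpace M] [MulAction (Torus k) M]
  [ContinuousSMul (Torus k) M]

/-- The orbit map `ev : T^k → M`, `ev t = t • x`. -/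
def ev (x : M) : C(Torus k, M) where
  toFun t := t • x
  continuous_toFun := continuous_id.smul continuous_const

/-- The homomorphism `ev_# : π₁(T^k, 1) → π₁(M, x)` induced by the orbit map. -/
def evPi (x : M) : FundamentalGroup (Torus k) 1 →* FundamentalGroup M x :=
  FundamentalGroup.mapOfEq (ev k x) (one_smul (Torus k) x)

/-- The image of `ev_#` is central in `π₁(M, x)`. -/
theorem evPi_commute (x : M) (g : FundamentalGroup (Torus k) 1) (d : FundamentalGroup M x) :
    evPi k x g * d = d * evPi k x g := by
  let act : C(Torus k × M, M) := ⟨fun p => p.1 • p.2, continuous_smul⟩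
  let A : FundamentalGroup (Torus k × M) (1, x) →* FundamentalGroup M x :=
    FundamentalGroup.mapOfEq act (one_smul (Torus k) x)
  let g' : FundamentalGroup (Torus k × M) (1, x) :=
    Path.Homotopic.prod g (Path.Homotopic.Quotient.refl x)
  let d' : FundamentalGroup (Torus k × M) (1, x) :=
    Path.Homotopic.prod (Path.Homotopic.Quotient.refl (1 : Torus k)) d
  have hg : A g' = evPi k x g := by
    refine (FundamentalGroup.mapOfEq_apply _ _ _).trans
      (Eq.trans ?_ (FundamentalGroup.mapOfEq_apply _ _ _).symm)
    simp only [g']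
    induction g using Path.Homotopic.Quotient.ind with | mk g =>
    rfl
  have hd : A d' = d := by
    simp only [A, d', FundamentalGroup.mapOfEq_apply]
    induction d using Path.Homotopic.Quotient.ind with | mk d =>
    refine congrArg Path.Homotopic.Quotient.mk (Path.ext (funext fun t => ?_))
    exact one_smul (Torus k) (d t)
  have hc : g' * d' = d' * g' := by
    simp only [FundamentalGroup.mul_def, g', d']
    refine (Path.Homotopic.comp_prod_eq_prod_comp _ _ _ _).trans
      (Eq.trans ?_ (Path.Homotopic.comp_prod_eq_prod_comp _ _ _ _).symm)
    congr 1
    · exact (mul_one (M := FundamentalGroup (Torus k) 1) g).trans (one_mul g).symm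
    · exact (one_mul (M := FundamentalGroup M x) d).trans (mul_one d).symm
  rw [← hg, ← hd, ← map_mul, hc, map_mul]

instance evPi_range_normal (x : M) : (evPi k x).range.Normal where
  conj_mem := by
    rintro _ ⟨g, rfl⟩ d
    exact ⟨g, by rw [← evPi_commute, mul_inv_cancel_right]⟩

/-- The quotient `Q = π₁(M, x) / ev_#(π₁(T^k))`. -/
abbrev Q (x : M) : Type := FundamentalGroup M x ⧸ (evPi k x).range

/-- The action is injective (at the base point `x`): `ev_#` is injective. -/
def IsInjectiveAction (x : M) : Prop := Function.Injective (evPi k x)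

/-- The action is injective-splitting (at the base point `x`): it is injective, so that there is a
central extension `1 → ℤ^k → π₁(M, x) → Q → 1` with `ℤ^k = π₁(T^k)`, and for some normal subgroup
`Q'` of finite index in `Q` the induced extension `1 → ℤ^k → π' → Q' → 1`, where `π'` is the
preimage of `Q'`, has a section `s : Q' → π'` that is a homomorphism. -/
def IsInjectiveSplitting (x : M) : Prop :=
  IsInjectiveAction k x ∧
    ∃ Q' : Subgroup (Q k x), Q'.Normal ∧ Q'.FiniteIndex ∧
      ∃ s : Q' →* Q'.comap (QuotientGroup.mk' (evPi k x).range),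
        ∀ q : Q', ((s q : FundamentalGroup M x) : Q k x) = q

/-- The action is homologically injective (at the base point `x`): the map
`ev_* : H_1(T^k; ℤ) → H_1(M; ℤ)` is injective. -/
def IsHomologicallyInjective (x : M) : Prop :=
  Function.Injective (homologyMap 1 (ev k x))

end Action

end TorusAction

end

/-! A transfer argument extends some multiple `d` of the winding homomorphism `π₁(T^k) → ℤ^k` along
`ev_#` to a homomorphism `φ : π₁(M) → ℤ^k`: a splitting of `π'` retracts it onto `ℤ^k`, and the
transfer from `π` to `π'` restricts to the `d`-th power on central elements. As `T^k` is a
`K(ℤ^k, 1)`, `φ` is induced by a map `f : M → T^k`; concretely, the affine `ℝ^k`-bundle with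
holonomy `φ` has a section, and `f` is its reduction modulo periods. On each orbit `f` is homotopic
to the power map `t ↦ t ^ d`. Power maps of the torus are injective on homology, by induction on
`k`: the short exact sequence `0 → C(Y) → C(Y) → C(B) → 0` with first map `τ - 1`, for an infinite
cyclic cover `Y → B` with generator `τ` homotopic to the identity, yields
`0 → H_{j+1}(Y) → H_{j+1}(B) → H_j(Y) → 0`, and hence also Pascal's rule for the Betti numbers.

For `k ≤ dim M`: otherwise some line in `ℝ^k` fixes a point `x`, and `f` is constant along it,
whereas on the orbit of `x` it lifts to `d` times the inclusion up to a bounded error.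
-/

noncomputable section

namespace TorusAction

open CategoryTheory Limits Topology

section InfiniteCyclicQuotient

/-- `π : S → B` is the quotient map for a free action of `ℤ` on the set `S`, the generator acting
by `τ`. -/
structure IsInfiniteCyclicQuotient {S B : Type*} (τ : Equiv.Perm S) (π : S → B) : Prop where
  surjective : Function.Surjective π
  apply_eq_iff : ∀ s s', π s = π s' ↔ τ.SameCycle s s'
  free : ∀ s (m : ℤ), (τ ^ m) s = s → m = 0

namespace IsInfiniteCyclicQuotient

variable {S B : Type*} {τ : Equiv.Perm S} {π : S → B}

theorem comp_perm (h : IsInfiniteCyclicQuotient τ π) : π ∘ τ = π :=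
  funext fun _ => (h.apply_eq_iff _ _).2 (Equiv.Perm.sameCycle_apply_left.2 (.refl _ _))

theorem congr {S' B' : Type*} (h : IsInfiniteCyclicQuotient τ π) (e : S ≃ S') (f : B ≃ B')
    {τ' : Equiv.Perm S'} {π' : S' → B'} (hτ : ∀ s, τ' (e s) = e (τ s))
    (hπ : ∀ s, π' (e s) = f (π s)) : IsInfiniteCyclicQuotient τ' π' := by
  obtain rfl : τ' = e.permCongr τ := Equiv.ext (e.surjective.forall.2 fun s => by simp [hτ])
  have hzpow (m : ℤ) : e.permCongr τ ^ m = e.permCongr (τ ^ m) :=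
    (map_zpow e.permCongrHom τ m).symm
  have hcycle (s t : S) : (e.permCongr τ).SameCycle (e s) (e t) ↔ τ.SameCycle s t :=
    exists_congr fun m => by simp [hzpow, Equiv.permCongr_apply]
  constructor
  · intro b
    obtain ⟨s, hs⟩ := h.surjective (f.symm b)
    exact ⟨e s, by rw [hπ, hs, f.apply_symm_apply]⟩
  · refine e.surjective.forall₂.2 fun s t => ?_
    rw [hcycle, hπ, hπ, f.injective.eq_iff, h.apply_eq_iff]
  · refine e.surjective.forall.2 fun s m hm => ?_
    rw [hzpow, Equiv.permCongr_apply, e.symm_apply_apply, e.injective.eq_iff] at hm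
    exact h.free s m hm

variable (R A : Type*) [Ring R] [AddCommGroup A] [Module R A]

theorem injective_lmapDomain_sub_id (h : IsInfiniteCyclicQuotient τ π) :
    Function.Injective
      (Finsupp.lmapDomain A R τ - LinearMap.id : (S →₀ A) →ₗ[R] (S →₀ A)) := by
  rw [injective_iff_map_eq_zero]
  intro x hx
  have hx : Finsupp.mapDomain τ x = x := by simpa [sub_eq_zero] using hx
  have invariant (s : S) : x (τ s) = x s := by
    conv_lhs => rw [← hx]
    exact Finsupp.mapDomain_apply τ.injective x s
  have invariant_pow (m : ℕ) (s : S) : x ((τ ^ m) s) = x s := by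
    induction m with
    | zero => rfl
    | succ m ih => rw [pow_succ', Equiv.Perm.mul_apply, invariant, ih]
  ext s
  by_contra hs
  have orbit_injective : Function.Injective fun m : ℕ => (τ ^ m) s := by
    intro m n hmn
    have hmn : (τ ^ (m : ℤ)) s = (τ ^ (n : ℤ)) s := by simpa using hmn
    have := h.free s (-n + m) (by
      rw [zpow_add, Equiv.Perm.mul_apply, hmn, ← Equiv.Perm.mul_apply, ← zpow_add]; simp)
    omega
  refine Set.infinite_range_of_injective orbit_injective (x.support.finite_toSet.subset ?_)
  rintro _ ⟨m, rfl⟩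
  simpa using (invariant_pow m s).trans_ne hs

variable {A} in
theorem single_zpow_sub_single_mem_range (τ : Equiv.Perm S) (m : ℤ) (s : S) (a : A) :
    Finsupp.single ((τ ^ m) s) a - Finsupp.single s a ∈
      LinearMap.range (Finsupp.lmapDomain A R τ - LinearMap.id : (S →₀ A) →ₗ[R] (S →₀ A)) := by
  have mem_step (s : S) : Finsupp.single (τ s) a - Finsupp.single s a ∈
      LinearMap.range (Finsupp.lmapDomain A R τ - LinearMap.id : (S →₀ A) →ₗ[R] (S →₀ A)) :=
    ⟨.single s a, by simp⟩
  induction m generalizing s with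
  | zero => simp
  | succ m ih =>
    rw [zpow_add_one, Equiv.Perm.mul_apply]
    simpa using add_mem (ih (τ s)) (mem_step s)
  | pred m ih =>
    rw [zpow_sub_one, Equiv.Perm.mul_apply]
    simpa using sub_mem (ih (τ⁻¹ s)) (mem_step (τ⁻¹ s))

theorem exact_lmapDomain_sub_id (h : IsInfiniteCyclicQuotient τ π) :
    Function.Exact (Finsupp.lmapDomain A R τ - LinearMap.id : (S →₀ A) →ₗ[R] (S →₀ A))
      (Finsupp.lmapDomain A R π) := by
  obtain ⟨σ, hσ⟩ := h.surjective.hasRightInverse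
  have mem_section (x : S →₀ A) : Finsupp.mapDomain (σ ∘ π) x - x ∈
      LinearMap.range (Finsupp.lmapDomain A R τ - LinearMap.id : (S →₀ A) →ₗ[R] (S →₀ A)) := by
    induction x using Finsupp.induction_linear with
    | zero => simp
    | add x y hx hy =>
      rw [Finsupp.mapDomain_add, add_sub_add_comm]
      exact add_mem hx hy
    | single s a =>
      obtain ⟨m, hm⟩ := (h.apply_eq_iff s (σ (π s))).1 (hσ _).symm
      simpa [hm] using single_zpow_sub_single_mem_range R τ m s a
  intro x
  constructor
  · intro hx
    have hx : Finsupp.mapDomain π x = 0 := hx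
    simpa [Finsupp.mapDomain_comp, hx] using mem_section x
  · rintro ⟨y, rfl⟩
    rw [LinearMap.sub_apply, map_sub, sub_eq_zero]
    change Finsupp.mapDomain π (Finsupp.mapDomain τ y) = Finsupp.mapDomain π y
    rw [← Finsupp.mapDomain_comp, h.comp_perm]

end IsInfiniteCyclicQuotient

end InfiniteCyclicQuotient

section SimplicialChains

open Simplicial

universe u

variable (R : Type u) [CommRing R]

/-- Simplicial chains of a simplicial set, as finitely supported functions on simplices. -/
def chainsIso (X : SSet.{u}) (n : ℕ) :
    (X.chainComplex (ModuleCat.of R R)).X n ≅ ModuleCat.of R (X _⦋n⦌ →₀ R) :=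
  (X.isColimitChainComplexXCofan (ModuleCat.of R R) n).coconePointUniqueUpToIso
    (ModuleCat.finsuppCoconeIsColimit R R (X _⦋n⦌))

theorem ι_chainsIso_hom {X : SSet.{u}} {n : ℕ} (x : X _⦋n⦌) :
    X.ιChainComplex x ≫ (chainsIso R X n).hom = ModuleCat.ofHom (Finsupp.lsingle x) :=
  IsColimit.comp_coconePointUniqueUpToIso_hom _ _ (Discrete.mk x)

theorem chainsIso_hom_naturality {X Y : SSet.{u}} (f : X ⟶ Y) (n : ℕ) :
    (SSet.chainComplexMap f (ModuleCat.of R R)).f n ≫ (chainsIso R Y n).hom =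
      (chainsIso R X n).hom ≫ ModuleCat.ofHom (Finsupp.lmapDomain R R (f.app _)) := by
  refine SSet.chainComplex_hom_ext fun x => ?_
  rw [SSet.ι_chainComplexMap_f_assoc, ι_chainsIso_hom, ← Category.assoc, ι_chainsIso_hom]
  ext
  simp

/-- The sequence `C(Y) ⟶ C(Y) ⟶ C(B)` of chain complexes given by `τ - 1` and a `τ`-invariant
map `p : Y ⟶ B`. -/
@[simps]
def orbitShortComplex {Y B : SSet.{u}} (τ : Y ⟶ Y) (p : Y ⟶ B) (h : τ ≫ p = p) :
    ShortComplex (ChainComplex (ModuleCat.{u} R) ℕ) where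
  X₁ := Y.chainComplex (ModuleCat.of R R)
  X₂ := Y.chainComplex (ModuleCat.of R R)
  X₃ := B.chainComplex (ModuleCat.of R R)
  f := SSet.chainComplexMap τ _ - 𝟙 _
  g := SSet.chainComplexMap p _
  zero := by rw [Preadditive.sub_comp, ← Functor.map_comp, h, Category.id_comp, sub_self]

theorem orbitShortComplex_shortExact {Y B : SSet.{u}} {τ : Y ⟶ Y} {p : Y ⟶ B} (h : τ ≫ p = p)
    (e : ∀ n : ℕ, Equiv.Perm (Y _⦋n⦌)) (he : ∀ n, ⇑(e n) = τ.app _)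
    (hp : ∀ n, IsInfiniteCyclicQuotient (e n) (p.app (.op ⦋n⦌))) :
    (orbitShortComplex R τ p h).ShortExact := by
  refine HomologicalComplex.shortExact_of_degreewise_shortExact _ fun n => ?_
  have hex := (hp n).exact_lmapDomain_sub_id R R
  let T : ShortComplex (ModuleCat.{u} R) := ShortComplex.mk
    (ModuleCat.ofHom (Finsupp.lmapDomain R R (e n) - LinearMap.id))
    (ModuleCat.ofHom (Finsupp.lmapDomain R R (p.app (.op ⦋n⦌))))
    (by ext1; exact hex.linearMap_comp_eq_zero)
  have hT : T.ShortExact :=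
    { exact := (ShortComplex.ShortExact.moduleCat_exact_iff_function_exact T).2 hex
      mono_f := (ModuleCat.mono_iff_injective _).2 ((hp n).injective_lmapDomain_sub_id R R)
      epi_g := (ModuleCat.epi_iff_surjective _).2
        (Finsupp.mapDomain_surjective (hp n).surjective) }
  have comm₁₂ : (SSet.chainComplexMap τ (ModuleCat.of R R) - 𝟙 _).f n ≫ (chainsIso R Y n).hom =
      (chainsIso R Y n).hom ≫ T.f := by
    rw [HomologicalComplex.sub_f_apply, Preadditive.sub_comp, chainsIso_hom_naturality, ← he]
    exact (Preadditive.comp_sub (chainsIso R Y n).hom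
      (ModuleCat.ofHom (Finsupp.lmapDomain R R (e n))) (𝟙 _)).symm
  have comm₂₃ : (SSet.chainComplexMap p (ModuleCat.of R R)).f n ≫ (chainsIso R B n).hom =
      (chainsIso R Y n).hom ≫ T.g :=
    chainsIso_hom_naturality R p n
  exact ShortComplex.shortExact_of_iso (ShortComplex.isoMk (S₂ := T)
    (chainsIso R Y n) (chainsIso R Y n) (chainsIso R B n) comm₁₂.symm comm₂₃.symm).symm hT

end SimplicialChains

section Homology

variable {X Y Z : Type} [TopologicalSpace X] [TopologicalSpace Y] [TopologicalSpace Z]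

/-- The complex of integral singular chains. -/
abbrev singularChains (X : Type) [TopologicalSpace X] : ChainComplex (ModuleCat.{0} ℤ) ℕ :=
  (TopCat.toSSet.obj (TopCat.of X)).chainComplex (ModuleCat.of ℤ ℤ)

/-- The map of singular chain complexes induced by a continuous map. -/
abbrev singularChainsMap (f : C(X, Y)) : singularChains X ⟶ singularChains Y :=
  SSet.chainComplexMap (TopCat.toSSet.map (TopCat.ofHom f)) (ModuleCat.of ℤ ℤ)

theorem singularChainsMap_comp (g : C(Y, Z)) (f : C(X, Y)) :
    singularChainsMap (g.comp f) = singularChainsMap f ≫ singularChainsMap g := by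
  rw [singularChainsMap, TopCat.ofHom_comp, Functor.map_comp]
  exact Functor.map_comp _ _ _

theorem homologyMap_id (j : ℕ) : homologyMap j (ContinuousMap.id X) = LinearMap.id := by
  rw [homologyMap]
  exact congrArg ModuleCat.Hom.hom (CategoryTheory.Functor.map_id _ _)

theorem homologyMap_comp (j : ℕ) (g : C(Y, Z)) (f : C(X, Y)) :
    homologyMap j (g.comp f) = homologyMap j g ∘ₗ homologyMap j f := by
  rw [homologyMap, TopCat.ofHom_comp]
  exact congrArg ModuleCat.Hom.hom (Functor.map_comp _ _ _)

theorem homologyMap_eq_of_homotopic (j : ℕ) {f g : C(X, Y)} (h : f.Homotopic g) :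
    homologyMap j f = homologyMap j g := by
  obtain ⟨H⟩ := h
  exact congrArg ModuleCat.Hom.hom
    (TopCat.Homotopy.congr_homologyMap_singularChainComplexFunctor
      (f := TopCat.ofHom f) (g := TopCat.ofHom g) H (ModuleCat.of ℤ ℤ) j)

/-- The isomorphism in homology induced by a homotopy equivalence. -/
def homologyEquiv (j : ℕ) (e : ContinuousMap.HomotopyEquiv X Y) :
    homology j X ≃ₗ[ℤ] homology j Y :=
  LinearEquiv.ofLinearMap (homologyMap j e.toFun) (homologyMap j e.invFun)
    (by rw [← homologyMap_comp, homologyMap_eq_of_homotopic j e.right_inv, homologyMap_id])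
    (by rw [← homologyMap_comp, homologyMap_eq_of_homotopic j e.left_inv, homologyMap_id])

theorem betti_eq_of_homotopyEquiv (j : ℕ) (e : ContinuousMap.HomotopyEquiv X Y) :
    betti j X = betti j Y :=
  (homologyEquiv j e).rank_eq

theorem isAddTorsionFree_homology_of_homotopyEquiv {j : ℕ} [IsAddTorsionFree (homology j Y)]
    (e : ContinuousMap.HomotopyEquiv X Y) : IsAddTorsionFree (homology j X) :=
  Function.Injective.isAddTorsionFree (homologyEquiv j e).toLinearMap.toAddMonoidHom
    (homologyEquiv j e).injective

theorem homologyMap_injective_of_homotopyEquiv (j : ℕ) (e : ContinuousMap.HomotopyEquiv Y X)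
    {p : C(X, X)} {q : C(Y, Y)} (he : e.toFun.comp q = p.comp e.toFun)
    (hp : Function.Injective (homologyMap j p)) : Function.Injective (homologyMap j q) := by
  have hcomp : homologyMap j e.toFun ∘ₗ homologyMap j q =
      homologyMap j p ∘ₗ homologyMap j e.toFun := by
    rw [← homologyMap_comp, he, homologyMap_comp]
  refine Function.Injective.of_comp (f := homologyMap j e.toFun) ?_
  rw [← LinearMap.coe_comp, hcomp]
  exact hp.comp (homologyEquiv j e).injective

end Homology

section InfiniteCyclicCover

/-- `p : Y → B` is a covering whose fibres are the orbits of a free action of `ℤ`, the generator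
acting by the homeomorphism `T`. -/
structure IsInfiniteCyclicCover {Y B : Type*} [TopologicalSpace Y] [TopologicalSpace B]
    (T : Y ≃ₜ Y) (p : C(Y, B)) : Prop where
  isCoveringMap : IsCoveringMap p
  isInfiniteCyclicQuotient : IsInfiniteCyclicQuotient T.toEquiv p

/-- Composition with a homeomorphism, as a permutation of the maps into a space. -/
def compPerm (A : Type*) {Y : Type*} [TopologicalSpace A] [TopologicalSpace Y] (T : Y ≃ₜ Y) :
    Equiv.Perm C(A, Y) where
  toFun s := (T : C(Y, Y)).comp s
  invFun s := (T.symm : C(Y, Y)).comp s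
  left_inv s := by ext; simp
  right_inv s := by ext; simp

theorem compPerm_zpow_apply {A Y : Type*} [TopologicalSpace A] [TopologicalSpace Y] (T : Y ≃ₜ Y)
    (m : ℤ) (s : C(A, Y)) (a : A) :
    (compPerm A T ^ m) s a = (T.toEquiv ^ m : Equiv.Perm Y) (s a) := by
  induction m generalizing s with
  | zero => rfl
  | succ m ih => rw [zpow_add_one, Equiv.Perm.mul_apply, ih, zpow_add_one]; rfl
  | pred m ih => rw [zpow_sub_one, Equiv.Perm.mul_apply, ih, zpow_sub_one]; rfl

namespace IsInfiniteCyclicCover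

theorem comp_left {Y B : Type*} [TopologicalSpace Y] [TopologicalSpace B] {T : Y ≃ₜ Y}
    {p : C(Y, B)} (h : IsInfiniteCyclicCover T p) (A : Type*) [TopologicalSpace A]
    [SimplyConnectedSpace A] [LocallyPathConnectedSpace A] :
    IsInfiniteCyclicQuotient (compPerm A T) (p.comp : C(A, Y) → C(A, B)) := by
  obtain ⟨a₀⟩ : Nonempty A := inferInstance
  have hq := h.isInfiniteCyclicQuotient
  refine ⟨fun f => ?_, fun s s' => ⟨fun hss' => ?_, ?_⟩, fun s m hm => ?_⟩
  · obtain ⟨y, hy⟩ := hq.surjective (f a₀)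
    obtain ⟨s, ⟨-, hs⟩, -⟩ := h.isCoveringMap.existsUnique_continuousMap_lifts f a₀ y hy
    exact ⟨s, DFunLike.coe_injective hs⟩
  · obtain ⟨m, hm⟩ := (hq.apply_eq_iff _ _).1 (DFunLike.congr_fun hss' a₀)
    refine ⟨m, DFunLike.coe_injective (h.isCoveringMap.eq_of_comp_eq (ContinuousMap.continuous _)
      (ContinuousMap.continuous _) (funext fun a => ?_) a₀ ?_)⟩
    · refine Eq.trans ?_ (DFunLike.congr_fun hss' a)
      refine (hq.apply_eq_iff _ _).2 (Equiv.Perm.SameCycle.symm ⟨m, ?_⟩)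
      rw [compPerm_zpow_apply]
    · rw [compPerm_zpow_apply, hm]
  · rintro ⟨m, rfl⟩
    exact ContinuousMap.ext fun a => (hq.apply_eq_iff _ _).2 ⟨m, (compPerm_zpow_apply T m s a).symm⟩
  · exact hq.free (s a₀) m (by rw [← compPerm_zpow_apply, hm])

variable {Y B : Type} [TopologicalSpace Y] [TopologicalSpace B] {T : Y ≃ₜ Y} {p : C(Y, B)}

theorem comp_eq (h : IsInfiniteCyclicCover T p) : p.comp (T : C(Y, Y)) = p :=
  DFunLike.coe_injective h.isInfiniteCyclicQuotient.comp_perm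

/-- The sequence `C(Y) ⟶ C(Y) ⟶ C(B)` of singular chain complexes given by `T - 1` and `p`. -/
abbrev shortComplex (h : IsInfiniteCyclicCover T p) :
    ShortComplex (ChainComplex (ModuleCat.{0} ℤ) ℕ) :=
  orbitShortComplex ℤ (TopCat.toSSet.map (TopCat.ofHom (T : C(Y, Y))))
    (TopCat.toSSet.map (TopCat.ofHom p))
    (by rw [← Functor.map_comp, ← TopCat.ofHom_comp, h.comp_eq])

theorem shortComplex_shortExact (h : IsInfiniteCyclicCover T p) : h.shortComplex.ShortExact := by
  let e (X : Type) [TopologicalSpace X] (n : ℕ) :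
      (TopCat.toSSet.obj (TopCat.of X)).obj (.op (.mk n)) ≃ C(stdSimplex ℝ (Fin (n + 1)), X) :=
    (TopCat.of X).toSSetObjEquiv (.op (.mk n))
  refine orbitShortComplex_shortExact ℤ _
    (fun n => (e Y n).symm.permCongr (compPerm (stdSimplex ℝ (Fin (n + 1))) T)) (fun n => ?_)
    fun n => ?_
  · funext s
    exact (e Y n).symm_apply_eq.2 rfl
  · have : ContractibleSpace (stdSimplex ℝ (Fin (n + 1))) :=
      (convex_stdSimplex ℝ _).contractibleSpace (Set.nonempty_coe_sort.1 inferInstance)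
    have : LocallyPathConnectedSpace (stdSimplex ℝ (Fin (n + 1))) :=
      (convex_stdSimplex ℝ _).locallyPathConnectedSpace
    exact (h.comp_left (stdSimplex ℝ (Fin (n + 1)))).congr (e Y n).symm (e B n).symm
      (fun s => by simp [Equiv.permCongr_apply]) fun s => (e B n).eq_symm_apply.2 rfl

theorem homologyMap_shortComplex_f (h : IsInfiniteCyclicCover T p)
    (hT : (T : C(Y, Y)).Homotopic (.id Y)) (j : ℕ) :
    HomologicalComplex.homologyMap h.shortComplex.f j = 0 := by
  refine (HomologicalComplex.homologyMap_sub _ _ j).trans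
    (sub_eq_zero.2 (Eq.trans ?_ (HomologicalComplex.homologyMap_id _ j).symm))
  ext1
  exact (homologyMap_eq_of_homotopic j hT).trans (homologyMap_id j)

theorem homologyMap_injective (h : IsInfiniteCyclicCover T p)
    (hT : (T : C(Y, Y)).Homotopic (.id Y)) (j : ℕ) : Function.Injective (homologyMap j p) :=
  (ModuleCat.mono_iff_injective _).1
    ((ShortComplex.exact_iff_mono _ (h.homologyMap_shortComplex_f hT j)).1
      (h.shortComplex_shortExact.homology_exact₂ j))

theorem homologyMap_zero_surjective (h : IsInfiniteCyclicCover T p) :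
    Function.Surjective (homologyMap 0 p) := by
  have := h.shortComplex_shortExact.epi_g
  have := HomologicalComplex.epi_homologyMap_of_epi_of_not_rel h.shortComplex.g 0 (by simp)
  exact (ModuleCat.epi_iff_surjective _).1 this

/-- The connecting homomorphism of the homology sequence of an infinite cyclic cover. -/
def boundary (h : IsInfiniteCyclicCover T p) (j : ℕ) : homology (j + 1) B →ₗ[ℤ] homology j Y :=
  (h.shortComplex_shortExact.δ (j + 1) j rfl).hom

theorem boundary_surjective (h : IsInfiniteCyclicCover T p)
    (hT : (T : C(Y, Y)).Homotopic (.id Y)) (j : ℕ) : Function.Surjective (h.boundary j) :=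
  (ModuleCat.epi_iff_surjective _).1
    ((ShortComplex.exact_iff_epi _ (h.homologyMap_shortComplex_f hT j)).1
      (h.shortComplex_shortExact.homology_exact₁ (j + 1) j rfl))

theorem exact_homologyMap_boundary (h : IsInfiniteCyclicCover T p) (j : ℕ) :
    Function.Exact (homologyMap (j + 1) p) (h.boundary j) :=
  (ShortComplex.ShortExact.moduleCat_exact_iff_function_exact _).1
    (h.shortComplex_shortExact.homology_exact₃ (j + 1) j rfl)

end IsInfiniteCyclicCover

end InfiniteCyclicCover

section InfiniteCyclicCoverMap

variable {Y Y' B B' : Type} [TopologicalSpace Y] [TopologicalSpace Y'] [TopologicalSpace B]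
  [TopologicalSpace B'] {T : Y ≃ₜ Y} {T' : Y' ≃ₜ Y'} {p : C(Y, B)} {p' : C(Y', B')}
  {P : C(Y, Y')} {q : C(B, B')} {d : ℕ}

/-- The chain map `(1 + T + ⋯ + T ^ (d - 1)) P`. -/
def normChainMap (T : Y' ≃ₜ Y') (P : C(Y, Y')) (d : ℕ) : singularChains Y ⟶ singularChains Y' :=
  ∑ i ∈ Finset.range d, singularChainsMap (((T ^ i : Y' ≃ₜ Y') : C(Y', Y')).comp P)

theorem normChainMap_comp (hP : P.comp (T : C(Y, Y)) = ((T' ^ d : Y' ≃ₜ Y') : C(Y', Y')).comp P) :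
    normChainMap T' P d ≫ (singularChainsMap (T' : C(Y', Y')) - 𝟙 _) =
      (singularChainsMap (T : C(Y, Y)) - 𝟙 _) ≫ singularChainsMap P := by
  have hpow (i : ℕ) : (T' : C(Y', Y')).comp (((T' ^ i : Y' ≃ₜ Y') : C(Y', Y')).comp P) =
      ((T' ^ (i + 1) : Y' ≃ₜ Y') : C(Y', Y')).comp P := by
    rw [pow_succ']
    rfl
  rw [normChainMap, Preadditive.sum_comp]
  simp only [Preadditive.comp_sub, Category.comp_id, ← singularChainsMap_comp, hpow]
  rw [Finset.sum_range_sub fun i : ℕ =>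
      singularChainsMap (((T' ^ i : Y' ≃ₜ Y') : C(Y', Y')).comp P),
    Preadditive.sub_comp, Category.id_comp, ← singularChainsMap_comp, hP]
  rfl

theorem homologyMap_normChainMap (hT' : (T' : C(Y', Y')).Homotopic (.id Y')) (P : C(Y, Y'))
    (d j : ℕ) :
    (HomologicalComplex.homologyMap (normChainMap T' P d) j).hom = d • homologyMap j P := by
  have hpow (i : ℕ) : ((T' ^ i : Y' ≃ₜ Y') : C(Y', Y')).Homotopic (.id Y') := by
    induction i with
    | zero => exact .refl _
    | succ i ih => exact ih.comp hT'
  have hsum : HomologicalComplex.homologyMap (normChainMap T' P d) j =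
      ∑ i ∈ Finset.range d, HomologicalComplex.homologyMap
        (singularChainsMap (((T' ^ i : Y' ≃ₜ Y') : C(Y', Y')).comp P)) j :=
    Functor.map_sum (HomologicalComplex.homologyFunctor (ModuleCat.{0} ℤ) (ComplexShape.down ℕ) j)
      _ _
  have hterm (i : ℕ) : HomologicalComplex.homologyMap
      (singularChainsMap (((T' ^ i : Y' ≃ₜ Y') : C(Y', Y')).comp P)) j =
      HomologicalComplex.homologyMap (singularChainsMap P) j := by
    ext1
    exact homologyMap_eq_of_homotopic j ((hpow i).comp (.refl P))
  rw [hsum, Finset.sum_congr rfl fun i _ => hterm i, Finset.sum_const, Finset.card_range]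
  rfl

namespace IsInfiniteCyclicCover

/-- The map of short exact sequences of chain complexes given by a map `P` of infinite cyclic covers
over `q` that raises the generator to the power `d`. -/
def shortComplexMap (h : IsInfiniteCyclicCover T p) (h' : IsInfiniteCyclicCover T' p')
    (hP : P.comp (T : C(Y, Y)) = ((T' ^ d : Y' ≃ₜ Y') : C(Y', Y')).comp P)
    (hq : q.comp p = p'.comp P) : h.shortComplex ⟶ h'.shortComplex where
  τ₁ := normChainMap T' P d
  τ₂ := singularChainsMap P
  τ₃ := singularChainsMap q
  comm₁₂ := normChainMap_comp hP
  comm₂₃ := by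
    refine (singularChainsMap_comp p' P).symm.trans ?_
    rw [← hq]
    exact singularChainsMap_comp q p

theorem boundary_homologyMap (h : IsInfiniteCyclicCover T p) (h' : IsInfiniteCyclicCover T' p')
    (hT' : (T' : C(Y', Y')).Homotopic (.id Y'))
    (hP : P.comp (T : C(Y, Y)) = ((T' ^ d : Y' ≃ₜ Y') : C(Y', Y')).comp P)
    (hq : q.comp p = p'.comp P) (j : ℕ) (c : homology (j + 1) B) :
    h'.boundary j (homologyMap (j + 1) q c) = d • homologyMap j P (h.boundary j c) := by
  have naturality := congrArg ModuleCat.Hom.hom <|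
    HomologicalComplex.HomologySequence.δ_naturality (h.shortComplexMap h' hP hq)
      h.shortComplex_shortExact h'.shortComplex_shortExact (j + 1) j rfl
  exact congr($naturality c).symm.trans
    congr($(homologyMap_normChainMap hT' P d j) (h.boundary j c))

theorem homologyMap_injective_of_lift (h : IsInfiniteCyclicCover T p)
    (h' : IsInfiniteCyclicCover T' p') (hT' : (T' : C(Y', Y')).Homotopic (.id Y'))
    [∀ j, IsAddTorsionFree (homology j Y')] (hd : d ≠ 0)
    (hP : P.comp (T : C(Y, Y)) = ((T' ^ d : Y' ≃ₜ Y') : C(Y', Y')).comp P)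
    (hq : q.comp p = p'.comp P) (hinj : ∀ j, Function.Injective (homologyMap j P)) (j : ℕ) :
    Function.Injective (homologyMap j q) := by
  have injective_on_range (b : homology j Y)
      (hb : homologyMap j q (homologyMap j p b) = 0) : homologyMap j p b = 0 := by
    rw [← LinearMap.comp_apply, ← homologyMap_comp, hq, homologyMap_comp,
      LinearMap.comp_apply] at hb
    rw [(map_eq_zero_iff _ (hinj j)).1 ((map_eq_zero_iff _ (h'.homologyMap_injective hT' j)).1 hb),
      map_zero]
  rw [injective_iff_map_eq_zero]
  intro c hc
  obtain ⟨b, rfl⟩ : c ∈ Set.range (homologyMap j p) := by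
    cases j with
    | zero => exact h.homologyMap_zero_surjective c
    | succ j =>
      have hdc := h.boundary_homologyMap h' hT' hP hq j c
      rw [hc, map_zero, eq_comm, smul_eq_zero_iff_right hd, map_eq_zero_iff _ (hinj j)] at hdc
      exact (h.exact_homologyMap_boundary j c).1 hdc
  exact injective_on_range b hc

theorem isAddTorsionFree_homology (h : IsInfiniteCyclicCover T p)
    (hT : (T : C(Y, Y)).Homotopic (.id Y)) [∀ j, IsAddTorsionFree (homology j Y)] (j : ℕ) :
    IsAddTorsionFree (homology j B) := by
  refine ⟨fun m hm => ?_⟩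
  refine (injective_iff_map_eq_zero (nsmulAddMonoidHom (α := homology j B) m)).2 fun c hc => ?_
  rw [nsmulAddMonoidHom_apply] at hc
  obtain ⟨b, rfl⟩ : c ∈ Set.range (homologyMap j p) := by
    cases j with
    | zero => exact h.homologyMap_zero_surjective c
    | succ j =>
      refine (h.exact_homologyMap_boundary j c).1 ((smul_eq_zero_iff_right hm).1 ?_)
      rw [← map_nsmul, hc, map_zero]
  rw [← map_nsmul, map_eq_zero_iff _ (h.homologyMap_injective hT j),
    smul_eq_zero_iff_right hm] at hc
  rw [hc, map_zero]

theorem betti_zero (h : IsInfiniteCyclicCover T p) (hT : (T : C(Y, Y)).Homotopic (.id Y)) :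
    betti 0 B = betti 0 Y :=
  (LinearEquiv.ofBijective (homologyMap 0 p)
    ⟨h.homologyMap_injective hT 0, h.homologyMap_zero_surjective⟩).rank_eq.symm

theorem betti_succ (h : IsInfiniteCyclicCover T p) (hT : (T : C(Y, Y)).Homotopic (.id Y)) (j : ℕ) :
    betti (j + 1) B = betti j Y + betti (j + 1) Y := by
  have rank_nullity := LinearMap.rank_range_add_rank_ker (h.boundary j)
  rw [LinearMap.range_eq_top.2 (h.boundary_surjective hT j), rank_top,
    (h.exact_homologyMap_boundary j).linearMap_ker_eq,
    rank_range_of_injective _ (h.homologyMap_injective hT (j + 1))] at rank_nullity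
  exact rank_nullity.symm

end IsInfiniteCyclicCover

end InfiniteCyclicCoverMap

section CircleFactor

theorem isCoveringMap_prodMap_id (X : Type*) {E B : Type*} [TopologicalSpace X]
    [TopologicalSpace E] [TopologicalSpace B] {f : E → B} (hf : IsCoveringMap f) :
    IsCoveringMap (Prod.map id f : X × E → X × B) := by
  intro b
  obtain ⟨hI, U, hbU, hU, hfU, H, hH⟩ := hf b.2
  refine IsEvenlyCovered.to_isEvenlyCovered_preimage (I := f ⁻¹' {b.2}) ⟨hI, Prod.snd ⁻¹' U, hbU,
    hU.preimage continuous_snd, hfU.preimage continuous_snd, ⟨?_, ?_, ?_⟩, ?_⟩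
  · exact
      { toFun := fun s => (⟨(s.1.1, f s.1.2), s.2⟩, (H ⟨s.1.2, s.2⟩).2)
        invFun := fun s => ⟨(s.1.1.1, H.symm (⟨s.1.1.2, s.1.2⟩, s.2)), by simp [← hH]⟩
        left_inv := fun s => by
          have : (⟨f s.1.2, s.2⟩ : U) = (H ⟨s.1.2, s.2⟩).1 := Subtype.ext (hH ⟨s.1.2, s.2⟩).symm
          simp [this]
        right_inv := fun s => by simp [← hH] }
  · have := hf.continuous
    exact Continuous.prodMk (by fun_prop) (by fun_prop)
  · exact Continuous.subtype_mk (by fun_prop) _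
  · exact fun _ => rfl

theorem IsInfiniteCyclicCover.prodMap_id (X : Type*) {Y B : Type*} [TopologicalSpace X]
    [TopologicalSpace Y] [TopologicalSpace B] {T : Y ≃ₜ Y} {p : C(Y, B)}
    (h : IsInfiniteCyclicCover T p) :
    IsInfiniteCyclicCover ((Homeomorph.refl X).prodCongr T) ((ContinuousMap.id X).prodMap p) where
  isCoveringMap := isCoveringMap_prodMap_id X h.isCoveringMap
  isInfiniteCyclicQuotient := by
    have hq := h.isInfiniteCyclicQuotient
    have hzpow (m : ℤ) (s : X × Y) : (((Homeomorph.refl X).prodCongr T).toEquiv ^ m) s =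
        (s.1, (T.toEquiv ^ m) s.2) := by
      induction m generalizing s with
      | zero => rfl
      | succ m ih => rw [zpow_add_one, Equiv.Perm.mul_apply, ih, zpow_add_one]; rfl
      | pred m ih => rw [zpow_sub_one, Equiv.Perm.mul_apply, ih, zpow_sub_one]; rfl
    refine ⟨Function.surjective_id.prodMap hq.surjective, fun s s' => ?_,
      fun s m hm => hq.free s.2 m ?_⟩
    · simp only [Equiv.Perm.SameCycle, hzpow, Prod.ext_iff, exists_and_left]
      exact and_congr_right' (hq.apply_eq_iff s.2 s'.2)
    · exact congrArg Prod.snd ((hzpow m s).symm.trans hm)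

theorem isInfiniteCyclicCover_circleExp :
    IsInfiniteCyclicCover (Homeomorph.addRight (2 * Real.pi)) Circle.exp where
  isCoveringMap := Circle.isCoveringMap_exp
  isInfiniteCyclicQuotient := by
    have hzpow (m : ℤ) (v : ℝ) :
        ((Homeomorph.addRight (2 * Real.pi)).toEquiv ^ m) v = v + m * (2 * Real.pi) := by
      change (Equiv.addRight (2 * Real.pi) ^ m) v = _
      simp
    refine ⟨Circle.exp_surjective, fun v w => ?_, fun v m hm => ?_⟩
    · rw [Equiv.Perm.sameCycle_comm]
      simp only [Equiv.Perm.SameCycle, hzpow, eq_comm (b := v)]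
      exact Circle.exp_eq_exp
    · simpa [hzpow, Real.pi_ne_zero] using hm

/-- The projection `X × E → X` along a real vector space, as a homotopy equivalence. -/
def fstHomotopyEquiv (X E : Type*) [TopologicalSpace X] [AddCommGroup E] [TopologicalSpace E]
    [IsTopologicalAddGroup E] [Module ℝ E] [ContinuousSMul ℝ E] :
    ContinuousMap.HomotopyEquiv (X × E) X where
  toFun := .fst
  invFun := (ContinuousMap.id X).prodMk (.const X 0)
  left_inv := ⟨ContinuousMap.Homotopy.prodMk (.refl .fst) (.affine (.const _ 0) .snd)⟩
  right_inv := .refl _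

theorem isInfiniteCyclicCover_prodMap_circleExp (X : Type*) [TopologicalSpace X] :
    IsInfiniteCyclicCover ((Homeomorph.refl X).prodCongr (Homeomorph.addRight (2 * Real.pi)))
      ((ContinuousMap.id X).prodMap Circle.exp) :=
  isInfiniteCyclicCover_circleExp.prodMap_id X

theorem prodCongr_addRight_homotopic_id (X : Type*) [TopologicalSpace X] (v : ℝ) :
    (((Homeomorph.refl X).prodCongr (Homeomorph.addRight v) : X × ℝ ≃ₜ X × ℝ) :
      C(X × ℝ, X × ℝ)).Homotopic (.id _) :=
  ⟨ContinuousMap.Homotopy.prodMap (.refl (.id X))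
    (.affine (Homeomorph.addRight v : C(ℝ, ℝ)) (.id ℝ))⟩

variable {X : Type} [TopologicalSpace X]

theorem isAddTorsionFree_homology_prod_circle [∀ j, IsAddTorsionFree (homology j X)] (j : ℕ) :
    IsAddTorsionFree (homology j (X × Circle)) :=
  have (i : ℕ) : IsAddTorsionFree (homology i (X × ℝ)) :=
    isAddTorsionFree_homology_of_homotopyEquiv (fstHomotopyEquiv X ℝ)
  (isInfiniteCyclicCover_prodMap_circleExp X).isAddTorsionFree_homology
    (prodCongr_addRight_homotopic_id X _) j

theorem betti_zero_prod_circle : betti 0 (X × Circle) = betti 0 X :=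
  ((isInfiniteCyclicCover_prodMap_circleExp X).betti_zero
    (prodCongr_addRight_homotopic_id X _)).trans
      (betti_eq_of_homotopyEquiv 0 (fstHomotopyEquiv X ℝ))

theorem betti_succ_prod_circle (j : ℕ) :
    betti (j + 1) (X × Circle) = betti j X + betti (j + 1) X := by
  rw [(isInfiniteCyclicCover_prodMap_circleExp X).betti_succ
    (prodCongr_addRight_homotopic_id X _),
    betti_eq_of_homotopyEquiv _ (fstHomotopyEquiv X ℝ),
    betti_eq_of_homotopyEquiv _ (fstHomotopyEquiv X ℝ)]

theorem homologyMap_prodMap_pow_injective [∀ j, IsAddTorsionFree (homology j X)] {q : C(X, X)}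
    (hq : ∀ j, Function.Injective (homologyMap j q)) {d : ℕ} (hd : d ≠ 0) (j : ℕ) :
    Function.Injective (homologyMap j (q.prodMap (.id Circle ^ d))) := by
  have (i : ℕ) : IsAddTorsionFree (homology i (X × ℝ)) :=
    isAddTorsionFree_homology_of_homotopyEquiv (fstHomotopyEquiv X ℝ)
  have shift_pow (i : ℕ) (v : X × ℝ) :
      (((Homeomorph.refl X).prodCongr (Homeomorph.addRight (2 * Real.pi))) ^ i) v =
        (v.1, v.2 + i * (2 * Real.pi)) := by
    induction i with
    | zero => simp
    | succ i ih =>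
      rw [pow_succ', Homeomorph.mul_apply, ih]
      exact Prod.ext rfl (by simp; ring)
  refine (isInfiniteCyclicCover_prodMap_circleExp X).homologyMap_injective_of_lift
    (isInfiniteCyclicCover_prodMap_circleExp X) (prodCongr_addRight_homotopic_id X _) hd
    (P := q.prodMap (d • .id ℝ)) ?_ ?_ (fun i => ?_) j
  · refine ContinuousMap.ext fun v => (Prod.ext ?_ ?_ : (_ : X × ℝ) = _) <;>
      simp [shift_pow, mul_add]
  · ext v <;> simp [Circle.exp_natCast_mul]
  · exact homologyMap_injective_of_homotopyEquiv i (fstHomotopyEquiv X ℝ) rfl (hq i)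

end CircleFactor

section TorusHomology

/-- The power map `t ↦ t ^ d` of the torus. -/
def torusPow (k d : ℕ) : C(Torus k, Torus k) := .id _ ^ d

/-- The splitting `T^(k+1) = T^k × S¹` of the first coordinate off the torus. -/
def torusSucc (k : ℕ) : Torus (k + 1) ≃ₜ Torus k × Circle where
  toFun t := (Fin.tail t, t 0)
  invFun q := Fin.cons q.2 q.1
  left_inv t := Fin.cons_self_tail t
  right_inv q := by simp
  continuous_toFun := by unfold Fin.tail; fun_prop
  continuous_invFun := by fun_prop

/-- The degree zero homology of the zero-dimensional torus, a point. -/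
def homologyZeroTorusZero : homology 0 (Torus 0) ≃ₗ[ℤ] (Torus 0 →₀ ℤ) :=
  ((AlgebraicTopology.singularHomologyFunctorZeroOfTotallyDisconnectedSpace (ModuleCat.{0} ℤ)
    (ModuleCat.of ℤ ℤ) (TopCat.of (Torus 0))) ≪≫
    (coproductIsCoproduct _).coconePointUniqueUpToIso
      (ModuleCat.finsuppCoconeIsColimit ℤ ℤ (Torus 0))).toLinearEquiv

instance subsingleton_homology_succ_torus_zero (j : ℕ) :
    Subsingleton (homology (j + 1) (Torus 0)) :=
  ModuleCat.subsingleton_of_isZero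
    (AlgebraicTopology.isZero_singularHomologyFunctor_of_totallyDisconnectedSpace
      (ModuleCat.{0} ℤ) (j + 1) (ModuleCat.of ℤ ℤ) (TopCat.of (Torus 0)) (by simp))

instance isAddTorsionFree_homology_torus (k j : ℕ) : IsAddTorsionFree (homology j (Torus k)) := by
  induction k generalizing j with
  | zero =>
    cases j with
    | zero =>
      exact Function.Injective.isAddTorsionFree homologyZeroTorusZero.toLinearMap.toAddMonoidHom
        homologyZeroTorusZero.injective
    | succ j => infer_instance
  | succ k ih =>
    have := isAddTorsionFree_homology_prod_circle (X := Torus k) j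
    exact isAddTorsionFree_homology_of_homotopyEquiv (torusSucc k).toHomotopyEquiv

theorem betti_torus (k j : ℕ) : betti j (Torus k) = k.choose j := by
  induction k generalizing j with
  | zero =>
    cases j with
    | zero => exact homologyZeroTorusZero.rank_eq.trans (by simp)
    | succ j => simp [betti]
  | succ k ih =>
    rw [betti_eq_of_homotopyEquiv j (torusSucc k).toHomotopyEquiv]
    cases j with
    | zero => rw [betti_zero_prod_circle, ih, Nat.choose_zero_right, Nat.choose_zero_right]
    | succ j => rw [betti_succ_prod_circle, ih, ih, Nat.choose_succ_succ, Nat.cast_add]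

theorem homologyMap_torusPow_injective (k : ℕ) {d : ℕ} (hd : d ≠ 0) (j : ℕ) :
    Function.Injective (homologyMap j (torusPow k d)) := by
  induction k generalizing j with
  | zero =>
    rw [show torusPow 0 d = .id _ from Subsingleton.elim _ _, homologyMap_id]
    exact Function.injective_id
  | succ k ih =>
    exact homologyMap_injective_of_homotopyEquiv j (torusSucc k).toHomotopyEquiv rfl
      (homologyMap_prodMap_pow_injective ih hd j)

end TorusHomology

section Transfer

theorem exists_leftInverse_of_section {N G P : Type*} [Group N] [Group G] [Group P]
    {ι : N →* G} {p : G →* P} (hι : Function.Injective ι) (hcenter : ι.range ≤ Subgroup.center G)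
    (hexact : p.ker = ι.range) {s : P →* G} (hs : Function.RightInverse s p) :
    ∃ r : G →* N, Function.LeftInverse r ι := by
  have hmem (g : G) : g * (s (p g))⁻¹ ∈ ι.range := by
    rw [← hexact, MonoidHom.mem_ker, map_mul, map_inv, hs, mul_inv_cancel]
  let fibrePart : G →* ι.range :=
    MonoidHom.mk' (fun g => ⟨g * (s (p g))⁻¹, hmem g⟩) fun g g' => by
      have hcomm := Subgroup.mem_center_iff.1 (hcenter (hmem g')) (s (p g))⁻¹
      simp only [Subtype.ext_iff, Subgroup.coe_mul, map_mul, mul_inv_rev]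
      rw [mul_assoc g (s (p g))⁻¹, hcomm]
      simp only [mul_assoc]
  refine ⟨(MonoidHom.ofInjective hι).symm.toMonoidHom.comp fibrePart, fun n => ?_⟩
  have hn : p (ι n) = 1 := MonoidHom.mem_ker.1 (hexact ▸ MonoidHom.mem_range.2 ⟨n, rfl⟩)
  have hpart : fibrePart (ι n) = MonoidHom.ofInjective hι n :=
    Subtype.ext (by simp [fibrePart, hn, MonoidHom.ofInjective_apply])
  exact ((MonoidHom.ofInjective hι).symm_apply_eq).2 hpart

theorem transfer_eq_pow_of_mem_center {G A : Type*} [Group G] [CommGroup A] {H : Subgroup G}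
    [H.FiniteIndex] (φ : H →* A) {g : G} (hg : g ∈ Subgroup.center G) (hgH : g ∈ H) :
    φ.transfer g = φ ⟨g, hgH⟩ ^ H.index := by
  rw [MonoidHom.transfer_eq_pow φ g fun m g₀ _ => by
    rw [mul_assoc, ← Subgroup.mem_center_iff.1 (pow_mem hg m) g₀, inv_mul_cancel_left], ← map_pow]
  rfl

variable {k : ℕ} {M : Type} [TopologicalSpace M] [MulAction (Torus k) M]
  [ContinuousSMul (Torus k) M]

theorem evPi_mem_center (x : M) (z : FundamentalGroup (Torus k) 1) :
    evPi k x z ∈ Subgroup.center (FundamentalGroup M x) :=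
  Subgroup.mem_center_iff.2 fun g => (evPi_commute k x z g).symm

theorem IsInjectiveSplitting.exists_hom_evPi_eq_pow {x : M} (h : IsInjectiveSplitting k x)
    {A : Type*} [CommGroup A] (ψ : FundamentalGroup (Torus k) 1 →* A) :
    ∃ d : ℕ, d ≠ 0 ∧ ∃ φ : FundamentalGroup M x →* A, ∀ z, φ (evPi k x z) = ψ z ^ d := by
  obtain ⟨hinj, Q', -, hfin, s, hs⟩ := h
  let π := QuotientGroup.mk' (evPi k x).range
  let H := Q'.comap π
  have hπ (z) : π (evPi k x z) = 1 := (QuotientGroup.eq_one_iff _).2 ⟨z, rfl⟩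
  have hH (z) : evPi k x z ∈ H := by simpa only [H, Subgroup.mem_comap, hπ] using one_mem Q'
  obtain ⟨r, hr⟩ := exists_leftInverse_of_section (ι := (evPi k x).codRestrict H hH)
    (p := π.subgroupComap Q') (s := s) (fun z z' hz => hinj congr($hz))
    (by
      rintro _ ⟨z, rfl⟩
      exact Subgroup.mem_center_iff.2 fun g =>
        Subtype.ext (Subgroup.mem_center_iff.1 (evPi_mem_center x z) g))
    (by
      ext g
      rw [MonoidHom.mem_ker, Subtype.ext_iff]
      exact (QuotientGroup.eq_one_iff _).trans
        ⟨fun ⟨z, hz⟩ => ⟨z, Subtype.ext hz⟩, fun ⟨z, hz⟩ => ⟨z, congr($hz)⟩⟩)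
    fun q => Subtype.ext (hs q)
  have : H.FiniteIndex := ⟨by
    rw [Subgroup.index_comap_of_surjective _ (QuotientGroup.mk'_surjective _)]
    exact hfin.index_ne_zero⟩
  refine ⟨H.index, this.index_ne_zero, (ψ.comp r).transfer, fun z => ?_⟩
  rw [transfer_eq_pow_of_mem_center _ (evPi_mem_center x z) (hH z)]
  exact congr(ψ $(hr z) ^ H.index)

end Transfer

section Winding

variable {k : ℕ}

/-- The exponential map `ℝ^k → T^k`, with kernel `2πℤ^k`. -/
def torusExp (v : Fin k → ℝ) : Torus k := fun i => Circle.exp (v i)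

@[fun_prop]
theorem continuous_torusExp : Continuous (torusExp (k := k)) := by
  unfold torusExp; fun_prop

@[simp]
theorem torusExp_zero : torusExp (0 : Fin k → ℝ) = 1 := by
  ext1 i; simp [torusExp]

theorem torusExp_add (v w : Fin k → ℝ) : torusExp (v + w) = torusExp v * torusExp w := by
  ext1 i; simp [torusExp, Circle.exp_add]

theorem torusExp_neg (v : Fin k → ℝ) : torusExp (-v) = (torusExp v)⁻¹ := by
  ext1 i; simp [torusExp]

theorem torusExp_nsmul (d : ℕ) (v : Fin k → ℝ) : torusExp (d • v) = torusExp v ^ d := by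
  ext1 i; simp [torusExp, Circle.exp_natCast_mul]

theorem isOpenQuotientMap_torusExp : IsOpenQuotientMap (torusExp (k := k)) :=
  IsOpenQuotientMap.piMap fun _ => ⟨Circle.exp_surjective, Circle.exp.continuous,
    isLocalHomeomorph_circleExp.isOpenMap⟩

/-- The lattice `2πℤ^k` of periods of the torus. -/
def periods (k : ℕ) : AddSubgroup (Fin k → ℝ) where
  carrier := {w | torusExp w = 1}
  zero_mem' := torusExp_zero
  add_mem' {v w} hv hw := by
    rw [Set.mem_ofPred_eq] at hv hw ⊢
    rw [torusExp_add, hv, hw, mul_one]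
  neg_mem' {v} hv := by
    rw [Set.mem_ofPred_eq] at hv ⊢
    rw [torusExp_neg, hv, inv_one]

theorem mem_periods {w : Fin k → ℝ} : w ∈ periods k ↔ torusExp w = 1 := Iff.rfl

theorem torusExp_eq_iff_sub_mem_periods {v w : Fin k → ℝ} :
    torusExp v = torusExp w ↔ w - v ∈ periods k := by
  rw [mem_periods, sub_eq_add_neg, torusExp_add, torusExp_neg, mul_inv_eq_one, eq_comm]

theorem isDiscrete_periods : _root_.IsDiscrete (periods k : Set (Fin k → ℝ)) := by
  choose U hUo hmem hinj using isLocalHomeomorph_circleExp.isLocallyInjective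
  refine isDiscrete_iff_forall_mem_exists_isOpen.2 fun w hw =>
    ⟨Set.univ.pi fun i => U (w i), isOpen_set_pi Set.finite_univ fun i _ => hUo (w i),
      Set.eq_singleton_iff_unique_mem.2 ⟨⟨fun i _ => hmem (w i), hw⟩, fun v hv => ?_⟩⟩
  have heq : torusExp v = torusExp w := (mem_periods.1 hv.2).trans (mem_periods.1 hw).symm
  exact funext fun i => hinj (w i) (hv.1 i trivial) (hmem (w i)) (congrFun heq i)

theorem isAddQuotientCoveringMap_torusExp :
    IsAddQuotientCoveringMap (torusExp (k := k)) (periods k) :=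
  isOpenQuotientMap_torusExp.isQuotientMap.isAddQuotientCoveringMap_of_addSubgroup (periods k)
    isDiscrete_periods
    (by simp only [torusExp_eq_iff_sub_mem_periods, sub_eq_add_neg, implies_true])

/-- The homomorphism `π₁(T^k) → 2πℤ^k` given by the end points of lifts of loops to `ℝ^k`. -/
def winding (k : ℕ) : FundamentalGroup (Torus k) 1 →* Multiplicative (periods k) :=
  MonoidHom.comp (MulOpposite.opMulEquiv (M := Multiplicative (periods k))).symm.toMonoidHom
    (isAddQuotientCoveringMap_torusExp.fundamentalGroupToMulOpposite ⟨0, torusExp_zero⟩)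

/-- The loop in the torus covered by the segment from `0` to a period. -/
def periodLoop (w : periods k) : Path (1 : Torus k) 1 :=
  ((Path.segment 0 (w : Fin k → ℝ)).map continuous_torusExp).cast torusExp_zero.symm w.2.symm

theorem winding_periodLoop (w : periods k) :
    winding k (Path.Homotopic.Quotient.mk (periodLoop w)) = Multiplicative.ofAdd w := by
  let hcov := isAddQuotientCoveringMap_torusExp (k := k)
  have hlift : hcov.isCoveringMap.monodromy (Path.Homotopic.Quotient.mk (periodLoop w))
      ⟨0, torusExp_zero⟩ = ⟨w, w.2⟩ :=
    hcov.isCoveringMap.monodromy_eq_of_map_eq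
      (Path.Homotopic.Quotient.mk (Path.segment 0 (w : Fin k → ℝ))) rfl
  have hunop := hcov.fundamentalGroupToMulOpposite_apply_eq_Iff (e := ⟨0, torusExp_zero⟩)
    (γ := Path.Homotopic.Quotient.mk (periodLoop w))
    (g := MulOpposite.op (Multiplicative.ofAdd w))
  exact congrArg MulOpposite.unop (hunop.2 (by rw [hlift]; exact add_zero (w : Fin k → ℝ)))

end Winding

section Cocycle

/-- An additive function of homotopy classes of paths, i.e. a `1`-cocycle of the fundamental
groupoid with values in `V`. -/
structure PathCocycle (X V : Type*) [TopologicalSpace X] [AddCommGroup V] where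
  toFun : ∀ {x y : X}, Path x y → V
  map_trans : ∀ {x y z : X} (p : Path x y) (q : Path y z), toFun (p.trans q) = toFun p + toFun q
  map_homotopic : ∀ {x y : X} {p q : Path x y}, p.Homotopic q → toFun p = toFun q

namespace PathCocycle

variable {X V : Type*} [TopologicalSpace X] [AddCommGroup V] (c : PathCocycle X V)

instance : CoeFun (PathCocycle X V) fun _ => ∀ {x y : X}, Path x y → V := ⟨toFun⟩

theorem map_congr {x y x' y' : X} (p : Path x y) (q : Path x' y') (h : ∀ t, p t = q t) :
    c p = c q := by
  obtain rfl : x = x' := by simpa using h 0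
  obtain rfl : y = y' := by simpa using h 1
  exact congrArg c.toFun (Path.ext (funext h))

variable {c} in
theorem map_eq_of_isSimplyConnected {U : Set X} (hU : IsSimplyConnected U) {x y : X}
    {p q : Path x y} (hp : ∀ t, p t ∈ U) (hq : ∀ t, q t ∈ U) : c p = c q := by
  have := hU.simplyConnectedSpace
  let x' : U := ⟨x, by simpa using hp 0⟩
  let y' : U := ⟨y, by simpa using hp 1⟩
  let p' : Path x' y' := ⟨⟨fun t => ⟨p t, hp t⟩, by fun_prop⟩, by simp [x'], by simp [y']⟩
  let q' : Path x' y' := ⟨⟨fun t => ⟨q t, hq t⟩, by fun_prop⟩, by simp [x'], by simp [y']⟩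
  exact c.map_homotopic
    ((SimplyConnectedSpace.paths_homotopic p' q').map ⟨Subtype.val, continuous_subtype_val⟩)

theorem exists_potential {U : Set X} (hU : IsSimplyConnected U) :
    ∃ q : X → V, ∀ {x y : X} (w : Path x y), (∀ t, w t ∈ U) → c w + q y = q x := by
  classical
  have hjoined := hU.isPathConnected.joinedIn
  obtain ⟨u, hu⟩ := hU.nonempty
  refine ⟨fun x => if hx : x ∈ U then c (hjoined x hx u hu).somePath else 0, fun {x y} w hw => ?_⟩
  have hx : x ∈ U := by simpa using hw 0
  have hy : y ∈ U := by simpa using hw 1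
  simp only [dif_pos hx, dif_pos hy]
  rw [← c.map_trans]
  refine map_eq_of_isSimplyConnected hU (fun t => ?_) (hjoined x hx u hu).somePath_mem
  have ht := Set.mem_range_self (f := w.trans (hjoined y hy u hu).somePath) t
  rw [Path.trans_range] at ht
  rcases ht with ⟨s, hs⟩ | ⟨s, hs⟩
  · exact hs ▸ hw s
  · exact hs ▸ (hjoined y hy u hu).somePath_mem s

/-- `F` is a continuous section of the affine local system with holonomy `c`: parallel transport
back to `x₁` along small paths makes it a continuous function near `x₁`. -/
def IsContinuousSection [TopologicalSpace V] (F : X → V) : Prop :=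
  ∀ x₁, ∃ W ∈ 𝓝 x₁, ∃ h : X → V, Continuous h ∧
    ∀ (x : X) (w : Path x₁ x), (∀ t, w t ∈ W) → F x + c w = h x

/-- The fibres of the local system are affine spaces, so that local sections can be averaged by a
partition of unity. -/
theorem exists_isContinuousSection [T2Space X] [ParacompactSpace X] [Module ℝ V]
    [TopologicalSpace V] [IsTopologicalAddGroup V] [ContinuousSMul ℝ V]
    (hX : ∀ x : X, ∃ U ∈ 𝓝 x, IsSimplyConnected U) : ∃ F : X → V, c.IsContinuousSection F := by
  choose U hUnhds hU using hX
  choose q hq using fun i => c.exists_potential (hU i)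
  obtain ⟨ρ, hρ⟩ := PartitionOfUnity.exists_isSubordinate isClosed_univ
    (fun i => interior (U i)) (fun i => isOpen_interior)
    fun x _ => Set.mem_iUnion.2 ⟨x, mem_interior_iff_mem_nhds.2 (hUnhds x)⟩
  refine ⟨fun x => ∑ᶠ i, ρ i x • q i x, fun x₁ => ?_⟩
  let S := ρ.fintsupport x₁
  let W : Set X := {x | ρ.fintsupport x ⊆ S ∧ ∀ i ∈ S, x ∈ U i}
  have hW : W ∈ 𝓝 x₁ := by
    refine (ρ.eventually_fintsupport_subset x₁).and ((Finset.eventually_all S).2 fun i hi => ?_)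
    exact mem_interior_iff_mem_nhds.1 (hρ i ((ρ.mem_fintsupport_iff x₁ i).1 hi))
  refine ⟨W, hW, fun x => ∑ i ∈ S, ρ i x • q i x₁,
    continuous_finsetSum _ fun i _ => (ρ i).continuous.smul continuous_const, fun x w hw => ?_⟩
  have hxW : x ∈ W := by simpa using hw 1
  have hsupport : ∀ i, ρ i x ≠ 0 → i ∈ S := fun i hi =>
    hxW.1 ((ρ.mem_fintsupport_iff x i).2 (subset_tsupport _ hi))
  have hsum : ∑ i ∈ S, ρ i x = 1 := by
    rw [← ρ.sum_eq_one (Set.mem_univ x), finsum_eq_sum_of_support_subset _ hsupport]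
  have hF : ∑ᶠ i, ρ i x • q i x = ∑ i ∈ S, ρ i x • q i x :=
    finsum_eq_sum_of_support_subset _ fun i hi => hsupport i (left_ne_zero_of_smul hi)
  calc ∑ᶠ i, ρ i x • q i x + c w
      = ∑ i ∈ S, ρ i x • (c w + q i x) := by
        simp only [smul_add, Finset.sum_add_distrib, ← Finset.sum_smul, hsum, one_smul, hF,
          add_comm]
    _ = ∑ i ∈ S, ρ i x • q i x₁ :=
        Finset.sum_congr rfl fun i hi => by rw [hq i w fun t => (hw t).2 i hi]

end PathCocycle

variable {X V : Type*} [TopologicalSpace X] [PathConnectedSpace X] [AddCommGroup V] {x₀ : X}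

/-- The class of the loop at `x₀` formed by a path and chosen paths from `x₀` to its ends. -/
def closeUp {x y : X} (p : Path x y) : FundamentalGroup X x₀ :=
  Path.Homotopic.Quotient.mk (((PathConnectedSpace.somePath x₀ x).trans p).trans
    (PathConnectedSpace.somePath x₀ y).symm)

/-- Products in Mathlib's fundamental group compose paths from right to left. -/
theorem closeUp_trans {x y z : X} (p : Path x y) (q : Path y z) :
    closeUp (x₀ := x₀) (p.trans q) = closeUp q * closeUp p := by
  rw [FundamentalGroup.mul_def]
  simp only [closeUp, Path.Homotopic.Quotient.mk_trans, Path.Homotopic.Quotient.mk_symm,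
    Path.Homotopic.Quotient.trans_assoc]
  rw [← Path.Homotopic.Quotient.trans_assoc (Path.Homotopic.Quotient.symm _)]
  simp

/-- The path cocycle extending a homomorphism from the fundamental group. -/
def holonomy (φ : FundamentalGroup X x₀ →* Multiplicative V) : PathCocycle X V where
  toFun p := (φ (closeUp p)).toAdd
  map_trans p q := by rw [closeUp_trans, map_mul, toAdd_mul, add_comm]
  map_homotopic {x y p q} h := by
    simp only [closeUp, Path.Homotopic.Quotient.mk_trans, Path.Homotopic.Quotient.eq.2 h]

theorem holonomy_loop (φ : FundamentalGroup X x₀ →* Multiplicative V) (p : Path x₀ x₀) :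
    holonomy φ p = (φ (Path.Homotopic.Quotient.mk p)).toAdd := by
  let g : FundamentalGroup X x₀ := Path.Homotopic.Quotient.mk (PathConnectedSpace.somePath x₀ x₀)
  let a : FundamentalGroup X x₀ := Path.Homotopic.Quotient.mk p
  have hconj : closeUp p = g⁻¹ * (a * g) := rfl
  have hφ : φ (closeUp p) = φ a := by
    rw [hconj, map_mul, map_mul, map_inv, mul_comm (φ a), inv_mul_cancel_left]
  exact congrArg Multiplicative.toAdd hφ

end Cocycle

section PathIntegral

namespace PathCocycle

variable {X V E : Type*} [TopologicalSpace X] [AddCommGroup V] [NormedAddCommGroup E]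
  [NormedSpace ℝ E] (c : PathCocycle X V)

/-- The primitive vanishing at `0` of the pullback of a path cocycle to a vector space. -/
def integral (o : C(E, X)) (v : E) : V := c ((Path.segment 0 v).map o.continuous)

theorem integral_add_segment (o : C(E, X)) (v w : E) :
    c.integral o v + c ((Path.segment v w).map o.continuous) = c.integral o w := by
  rw [integral, integral, ← c.map_trans, ← Path.map_trans]
  exact c.map_homotopic ((SimplyConnectedSpace.paths_homotopic _ _).map _)

theorem integral_add_of_periodic {o : C(E, X)} {w : E} (hw : ∀ v, o (w + v) = o v) (v : E) :
    c.integral o (w + v) = c.integral o w + c.integral o v := by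
  rw [← c.integral_add_segment o w (w + v), integral, integral]
  congr 1
  refine c.map_congr _ _ fun t => ?_
  have hsegment : Path.segment w (w + v) t = w + Path.segment 0 v t := by
    simp [AffineMap.lineMap_apply, add_comm]
  simp only [Path.map_coe, Function.comp_apply, hsegment, hw]

variable {c} [TopologicalSpace V] {F : X → V}

theorem IsContinuousSection.continuous_add_integral [ContinuousAdd V]
    (hF : c.IsContinuousSection F) (o : C(E, X)) :
    Continuous fun v => F (o v) + c.integral o v := by
  refine continuous_iff_continuousAt.2 fun v₁ => ?_
  obtain ⟨W, hW, u, hu, hFu⟩ := hF (o v₁)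
  obtain ⟨ε, hε, hball⟩ := Metric.mem_nhds_iff.1 (o.continuous.continuousAt.preimage_mem_nhds hW)
  have hcont : Continuous fun v => u (o v) + c.integral o v₁ := by fun_prop
  refine hcont.continuousAt.congr ?_
  filter_upwards [Metric.ball_mem_nhds v₁ hε] with v hv
  rw [← hFu _ ((Path.segment v₁ v).map o.continuous) fun t => hball
    ((convex_ball v₁ ε).lineMap_mem (Metric.mem_ball_self hε) hv t.2),
    ← c.integral_add_segment o v₁ v]
  abel

theorem IsContinuousSection.continuous_comp [LocallyPathConnectedSpace X] {Y : Type*}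
    [TopologicalSpace Y] {e : V → Y} (hF : c.IsContinuousSection F) (he : Continuous e)
    (hc : ∀ {x y : X} (p : Path x y) (v : V), e (v + c p) = e v) :
    Continuous fun x => e (F x) := by
  refine continuous_iff_continuousAt.2 fun x₁ => ?_
  obtain ⟨W, hW, u, hu, hFu⟩ := hF x₁
  obtain ⟨W', ⟨hW', hconn⟩, hsub⟩ := (path_connected_basis x₁).mem_iff.1 hW
  refine (he.comp hu).continuousAt.congr ?_
  filter_upwards [hW'] with x hx
  obtain ⟨w, hw⟩ := hconn.joinedIn x₁ (mem_of_mem_nhds hW') x hx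
  rw [Function.comp_apply, ← hFu x w fun t => hsub (hw t), hc]

end PathCocycle

end PathIntegral

section TorusMap

variable {k : ℕ} {M : Type} [TopologicalSpace M]

section PeriodCocycle

variable [PathConnectedSpace M] {x : M}

/-- The holonomy of a homomorphism to the periods, with values in `ℝ^k` so that its sections can
be averaged. -/
def periodCocycle (φ : FundamentalGroup M x →* Multiplicative (periods k)) :
    PathCocycle M (Fin k → ℝ) :=
  holonomy ((AddMonoidHom.toMultiplicative (periods k).subtype).comp φ)

theorem torusExp_add_periodCocycle (φ : FundamentalGroup M x →* Multiplicative (periods k))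
    {y z : M} (p : Path y z) (v : Fin k → ℝ) :
    torusExp (v + periodCocycle φ p) = torusExp v := by
  rw [torusExp_add, show torusExp (periodCocycle φ p) = 1 from (φ (closeUp p)).toAdd.2, mul_one]

end PeriodCocycle

variable [MulAction (Torus k) M]

/-- `f` restricts to the `d`-th power map on the orbit of `x`, up to a factor that lifts to
`ℝ^k`. -/
def IsPowAlongOrbit (f : C(M, Torus k)) (d : ℕ) (x : M) : Prop :=
  ∃ g : C(Torus k, Fin k → ℝ), ∀ t, f (t • x) = torusExp (g t) * t ^ d

variable [ContinuousSMul (Torus k) M]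

/-- The composition `ℝ^k → T^k → M` of the exponential map and the orbit map at `x`. -/
def orbitExp (k : ℕ) {M : Type} [TopologicalSpace M] [MulAction (Torus k) M]
    [ContinuousSMul (Torus k) M] (x : M) : C(Fin k → ℝ, M) :=
  (ev k x).comp ⟨torusExp, continuous_torusExp⟩

theorem orbitExp_apply (x : M) (v : Fin k → ℝ) : orbitExp k x v = torusExp v • x := rfl

theorem IsPowAlongOrbit.comp_ev_homotopic {f : C(M, Torus k)} {d : ℕ} {x : M}
    (hf : IsPowAlongOrbit f d x) : (f.comp (ev k x)).Homotopic (torusPow k d) := by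
  obtain ⟨g, hg⟩ := hf
  exact ⟨{
    toFun q := torusExp ((1 - (q.1 : ℝ)) • g q.2) * q.2 ^ d
    continuous_toFun := by fun_prop
    map_zero_left t := by simp [ev, hg]
    map_one_left t := by simp [torusPow] }⟩

variable [PathConnectedSpace M] {x : M}

theorem integral_periodCocycle {φ : FundamentalGroup M x →* Multiplicative (periods k)} {d : ℕ}
    (hφ : ∀ z, φ (evPi k x z) = winding k z ^ d) (w : periods k) :
    (periodCocycle φ).integral (orbitExp k x) w = d • (w : Fin k → ℝ) := by
  let orbitLoop : Path x x :=
    ((periodLoop w).map (ev k x).continuous).cast (one_smul _ x).symm (one_smul _ x).symm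
  have hloop : evPi k x (Path.Homotopic.Quotient.mk (periodLoop w)) =
      Path.Homotopic.Quotient.mk orbitLoop := FundamentalGroup.mapOfEq_apply _ _ _
  calc (periodCocycle φ).integral (orbitExp k x) w
      = periodCocycle φ orbitLoop := (periodCocycle φ).map_congr _ _ fun _ => rfl
    _ = (φ (Path.Homotopic.Quotient.mk orbitLoop)).toAdd := by
        rw [periodCocycle, holonomy_loop]; rfl
    _ = d • (w : Fin k → ℝ) := by
        rw [← hloop, hφ, winding_periodLoop]; rfl

theorem exists_isPowAlongOrbit [T2Space M] [ParacompactSpace M] [LocallyPathConnectedSpace M]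
    (hM : ∀ y : M, ∃ U ∈ 𝓝 y, IsSimplyConnected U)
    {φ : FundamentalGroup M x →* Multiplicative (periods k)} {d : ℕ}
    (hφ : ∀ z, φ (evPi k x z) = winding k z ^ d) :
    ∃ f : C(M, Torus k), IsPowAlongOrbit f d x := by
  let c := periodCocycle φ
  obtain ⟨F, hF⟩ := c.exists_isContinuousSection hM
  let f : C(M, Torus k) :=
    ⟨fun y => torusExp (F y), hF.continuous_comp continuous_torusExp (torusExp_add_periodCocycle φ)⟩
  let G : C(Fin k → ℝ, Fin k → ℝ) :=
    ⟨fun v => F (orbitExp k x v) + c.integral (orbitExp k x) v - d • v,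
      (hF.continuous_add_integral _).sub (continuous_const_smul d)⟩
  have hG : Function.FactorsThrough G torusExp := by
    intro v v' hv
    obtain ⟨w, rfl⟩ : ∃ w : periods k, v' = w + v :=
      ⟨⟨v' - v, torusExp_eq_iff_sub_mem_periods.1 hv⟩, by simp⟩
    have hperiod : ∀ u, orbitExp k x (w + u) = orbitExp k x u := fun u => by
      rw [orbitExp_apply, torusExp_add, mem_periods.1 w.2, one_mul, orbitExp_apply]
    have hint := c.integral_add_of_periodic hperiod v
    rw [integral_periodCocycle hφ] at hint
    simp only [G, ContinuousMap.coe_mk, hperiod, hint, smul_add]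
    abel
  let E : C(Fin k → ℝ, Torus k) := ⟨torusExp, continuous_torusExp⟩
  have hE : IsQuotientMap E := isOpenQuotientMap_torusExp.isQuotientMap
  refine ⟨f, hE.lift G hG, fun t => ?_⟩
  obtain ⟨v, rfl⟩ := isOpenQuotientMap_torusExp.surjective t
  have hlift : hE.lift G hG (torusExp v) = G v := congr($(hE.lift_comp G hG) v)
  rw [hlift, ← torusExp_nsmul, ← torusExp_add]
  simp only [G, ContinuousMap.coe_mk, sub_add_cancel]
  exact (torusExp_add_periodCocycle φ _ _).symm

end TorusMap

section Dimension

theorem stronglyLocallyContractibleSpace_of_model {E H : Type*} [NormedAddCommGroup E]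
    [NormedSpace ℝ E] [TopologicalSpace H] (I : ModelWithCorners ℝ E H) :
    StronglyLocallyContractibleSpace H := by
  refine .of_bases (p := fun _ ε => 0 < ε) (s := fun y ε => I ⁻¹' Metric.ball (I y) ε)
    (fun y => ?_) fun y ε hε => ?_
  · rw [I.isClosedEmbedding.isInducing.nhds_eq_comap]
    exact Metric.nhds_basis_ball.comap I
  · have hconvex : Convex ℝ (Metric.ball (I y) ε ∩ Set.range I) :=
      (convex_ball _ _).inter I.convex_range
    have := hconvex.contractibleSpace ⟨I y, Metric.mem_ball_self hε, y, rfl⟩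
    let e := I.isClosedEmbedding.isEmbedding.homeomorphImage (I ⁻¹' Metric.ball (I y) ε)
    rw [← Set.image_preimage_eq_inter_range] at this
    exact e.contractibleSpace

theorem stronglyLocallyContractibleSpace_of_chartedSpace (H M : Type*) [TopologicalSpace H]
    [StronglyLocallyContractibleSpace H] [TopologicalSpace M] [ChartedSpace H M] :
    StronglyLocallyContractibleSpace M := by
  refine .of_bases (p := fun x S => S ∈ 𝓝 (chartAt H x x) ∧ ContractibleSpace S ∧
    S ⊆ (chartAt H x).target) (s := fun x S => (chartAt H x).symm '' S) (fun x => ?_)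
    fun x S ⟨_, hS, hsub⟩ => ?_
  · have hx := mem_chart_source H x
    have hmap := (chartAt H x).symm.map_nhds_eq ((chartAt H x).map_source hx)
    rw [(chartAt H x).left_inv hx] at hmap
    rw [← hmap]
    exact (contractible_subset_basis (chartAt H x).open_target
      ((chartAt H x).map_source hx)).map (chartAt H x).symm
  · exact ((chartAt H x).symm.homeomorphOfImageSubsetSource hsub rfl).symm.contractibleSpace

theorem exists_mem_nhds_isSimplyConnected {X : Type*} [TopologicalSpace X]
    [StronglyLocallyContractibleSpace X] (x : X) : ∃ U ∈ 𝓝 x, IsSimplyConnected U :=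
  let ⟨U, hU, _⟩ := (contractible_basis x).ex_mem
  ⟨U, hU, SimplyConnectedSpace.ofContractible U⟩

variable {k : ℕ}

theorem IsPowAlongOrbit.eq_zero_of_line_smul_eq {M : Type} [TopologicalSpace M]
    [MulAction (Torus k) M] {f : C(M, Torus k)} {d : ℕ} {x : M} (hf : IsPowAlongOrbit f d x)
    (hd : d ≠ 0) {v : Fin k → ℝ} (hv : ∀ t : ℝ, torusExp (t • v) • x = x) : v = 0 := by
  obtain ⟨g, hg⟩ := hf
  let lift : ℝ → Fin k → ℝ := fun t => g (torusExp (t • v)) + d • t • v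
  have hlift : ∀ t, torusExp (lift t) = f x := fun t => by
    rw [torusExp_add, torusExp_nsmul, ← hg, hv]
  have hconst : lift = fun _ => lift 0 :=
    isAddQuotientCoveringMap_torusExp.isCoveringMap.eq_of_comp_eq (by fun_prop) (by fun_prop)
      (funext fun t => (hlift t).trans (hlift 0).symm) 0 rfl
  obtain ⟨C, hC⟩ := (isCompact_range g.continuous).isBounded.exists_norm_le
  have hbound : ∀ t : ℝ, |t| * ‖d • v‖ ≤ C + C := fun t => by
    have heq : t • d • v = g (torusExp ((0 : ℝ) • v)) - g (torusExp (t • v)) := by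
      have := congrFun hconst t
      simp only [lift, zero_smul, smul_zero, add_zero] at this ⊢
      rw [← this, smul_comm]
      abel
    rw [← Real.norm_eq_abs, ← norm_smul, heq]
    exact (norm_sub_le _ _).trans (add_le_add (hC _ ⟨_, rfl⟩) (hC _ ⟨_, rfl⟩))
  by_contra hv0
  have hpos : 0 < ‖d • v‖ := norm_pos_iff.2 (smul_ne_zero hd hv0)
  have h := hbound ((C + C + 1) / ‖d • v‖)
  rw [abs_div, abs_norm, div_mul_cancel₀ _ hpos.ne'] at h
  linarith [le_abs_self (C + C + 1)]

theorem mdifferentiableAt_torusExp (v : Fin k → ℝ) :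
    MDifferentiableAt 𝓘(ℝ, Fin k → ℝ) (torusModel k) torusExp v := by
  have hcoord : ∀ i, MDifferentiableAt 𝓘(ℝ, Fin k → ℝ) (𝓡 1)
      (fun v : Fin k → ℝ => Circle.exp (v i)) v := fun i =>
    ((contMDiff_circleExp (m := 1)).mdifferentiableAt one_ne_zero).comp v
      (ContinuousLinearMap.proj (R := ℝ) (φ := fun _ : Fin k => ℝ) i).mdifferentiableAt
  exact (mdifferentiableAt_iff _ _).2 ⟨continuous_torusExp.continuousAt,
    differentiableWithinAt_pi.2 fun i => ((mdifferentiableAt_iff _ _).1 (hcoord i)).2⟩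

variable {E H : Type*} [NormedAddCommGroup E] [NormedSpace ℝ E] [TopologicalSpace H]
  {I : ModelWithCorners ℝ E H}

theorem eq_of_hasMFDerivAt_zero {M : Type*} [TopologicalSpace M] [ChartedSpace H M]
    [IsManifold I 1 M] {c : ℝ → M} (hc : ∀ t, HasMFDerivAt 𝓘(ℝ, ℝ) I c t 0) (s t : ℝ) :
    c s = c t := by
  have hcont : Continuous c := continuous_iff_continuousAt.2 fun t => (hc t).continuousAt
  refine IsLocallyConstant.apply_eq_of_preconnectedSpace
    ((IsLocallyConstant.iff_eventually_eq c).2 fun t₀ => ?_) s t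
  let e := extChartAt I (c t₀)
  obtain ⟨ε, hε, hball⟩ := Metric.mem_nhds_iff.1 (hcont.continuousAt.preimage_mem_nhds
    (extChartAt_source_mem_nhds (I := I) (c t₀)))
  have hderiv : ∀ u ∈ Metric.ball t₀ ε, HasFDerivAt (e ∘ c) (0 : ℝ →L[ℝ] E) u := by
    intro u hu
    have he : MDifferentiableAt I 𝓘(ℝ, E) e (c u) :=
      mdifferentiableAt_extChartAt (by rw [← extChartAt_source I]; exact hball hu)
    have hcomp := he.hasMFDerivAt.comp u (hc u)
    rw [ContinuousLinearMap.comp_zero] at hcomp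
    exact hcomp.hasFDerivAt
  have hconst : ∀ u ∈ Metric.ball t₀ ε, e (c u) = e (c t₀) := fun u hu =>
    Metric.isOpen_ball.is_const_of_fderiv_eq_zero (f := e ∘ c) (convex_ball t₀ ε).isPreconnected
      (fun u hu => (hderiv u hu).differentiableAt.differentiableWithinAt)
      (fun u hu => (hderiv u hu).fderiv) hu (Metric.mem_ball_self hε)
  filter_upwards [Metric.ball_mem_nhds t₀ hε] with u hu
  exact e.injOn (hball hu) (mem_extChartAt_source _) (hconst u hu)

variable {M : Type} [TopologicalSpace M] [ChartedSpace H M] [MulAction (Torus k) M]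
  [ContinuousSMul (Torus k) M] [ContMDiffSMul (torusModel k) I 1 (Torus k) M]

variable (I) in
theorem mdifferentiableAt_orbitExp (x : M) (v : Fin k → ℝ) :
    MDifferentiableAt 𝓘(ℝ, Fin k → ℝ) I (orbitExp k x) v := by
  have horbit : ContMDiff (torusModel k) I 1 fun t : Torus k => t • x :=
    contMDiff_id.smul (I := torusModel k) contMDiff_const
  exact (horbit.mdifferentiableAt one_ne_zero).comp v (mdifferentiableAt_torusExp v)

/-- By equivariance, an orbit curve with vanishing velocity at time `0` has vanishing velocity. -/
theorem torusExp_smul_smul_eq_of_mfderiv_eq_zero [IsManifold I 1 M] {x : M} {v : Fin k → ℝ}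
    (hv : mfderiv 𝓘(ℝ, Fin k → ℝ) I (orbitExp k x) 0 v = 0) (t : ℝ) :
    torusExp (t • v) • x = x := by
  let L : ℝ →L[ℝ] (Fin k → ℝ) := ContinuousLinearMap.toSpanSingleton ℝ v
  let c : ℝ → M := fun t => orbitExp k x (L t)
  have hc0 : HasMFDerivAt 𝓘(ℝ, ℝ) I c 0 (0 : ℝ →L[ℝ] E) := by
    have horbit : HasMFDerivAt 𝓘(ℝ, Fin k → ℝ) I (orbitExp k x) (L 0)
        (mfderiv 𝓘(ℝ, Fin k → ℝ) I (orbitExp k x) 0) := by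
      rw [map_zero]
      exact (mdifferentiableAt_orbitExp I x 0).hasMFDerivAt
    refine (horbit.comp 0 L.hasMFDerivAt).congr_mfderiv (ContinuousLinearMap.ext_ring ?_)
    exact (congrArg (mfderiv 𝓘(ℝ, Fin k → ℝ) I (orbitExp k x) 0) (one_smul ℝ v)).trans hv
  have hc : ∀ t, HasMFDerivAt 𝓘(ℝ, ℝ) I c t (0 : ℝ →L[ℝ] E) := by
    intro t
    have hshift : HasMFDerivAt 𝓘(ℝ, ℝ) 𝓘(ℝ, ℝ) (fun s : ℝ => s - t) t
        (ContinuousLinearMap.id ℝ ℝ) := ((hasFDerivAt_id t).sub_const t).hasMFDerivAt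
    have hsmul : MDifferentiableAt I I (fun y : M => torusExp (L t) • y) (c (t - t)) :=
      (ContMDiffSMul.contMDiff_const_smul (I := torusModel k) (n := 1)
        (torusExp (L t))).mdifferentiableAt one_ne_zero
    rw [← sub_self t] at hc0
    have hcomp := HasMFDerivAt.comp (f := fun s : ℝ => s - t) t
      (hsmul.hasMFDerivAt.comp (t - t) hc0) hshift
    have hzero : HasMFDerivAt 𝓘(ℝ, ℝ) I _ t (0 : ℝ →L[ℝ] E) :=
      hcomp.congr_mfderiv (ContinuousLinearMap.ext fun _ =>
        map_zero (mfderiv I I (fun y : M => torusExp (L t) • y) (c (t - t))))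
    refine hzero.congr_of_eventuallyEq (Filter.Eventually.of_forall fun s => ?_)
    simp only [c, orbitExp_apply, Function.comp_apply, smul_smul, ← torusExp_add, ← map_add,
      add_sub_cancel]
  simpa [c, orbitExp_apply, L] using eq_of_hasMFDerivAt_zero hc t 0

variable (I) in
theorem IsPowAlongOrbit.le_finrank [FiniteDimensional ℝ E] [IsManifold I 1 M] {f : C(M, Torus k)}
    {d : ℕ} {x : M} (hf : IsPowAlongOrbit f d x) (hd : d ≠ 0) : k ≤ Module.finrank ℝ E := by
  by_contra! hlt
  let A : (Fin k → ℝ) →L[ℝ] E := mfderiv 𝓘(ℝ, Fin k → ℝ) I (orbitExp k x) 0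
  have hker : A.toLinearMap.ker ≠ ⊥ := LinearMap.ker_ne_bot_of_finrank_lt (by simpa using hlt)
  obtain ⟨v, hv, hv0⟩ := Submodule.exists_mem_ne_zero_of_ne_bot hker
  exact hv0 (hf.eq_zero_of_line_smul_eq hd (torusExp_smul_smul_eq_of_mfderiv_eq_zero hv))

end Dimension

theorem ev_homotopic {k : ℕ} {M : Type} [TopologicalSpace M] [MulAction (Torus k) M]
    [ContinuousSMul (Torus k) M] {x y : M} (p : Path x y) : (ev k x).Homotopic (ev k y) :=
  ⟨{
    toFun q := q.2 • p q.1
    continuous_toFun := by fun_prop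
    map_zero_left t := by simp [ev]
    map_one_left t := by simp [ev] }⟩

theorem two_pow_le_sum_of_choose_le {k n : ℕ} (hkn : k ≤ n) {b : ℕ → Cardinal}
    (hb : ∀ j, (k.choose j : Cardinal) ≤ b j) :
    (2 : Cardinal) ^ k ≤ ∑ j ∈ Finset.range (n + 1), b j :=
  calc (2 : Cardinal) ^ k = ∑ j ∈ Finset.range (k + 1), (k.choose j : Cardinal) := by
        rw [← Nat.cast_sum, Nat.sum_range_choose, Nat.cast_pow, Nat.cast_ofNat]
    _ ≤ ∑ j ∈ Finset.range (k + 1), b j := Finset.sum_le_sum fun j _ => hb j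
    _ ≤ ∑ j ∈ Finset.range (n + 1), b j :=
        Finset.sum_le_sum_of_subset (Finset.range_mono (by omega))

theorem IsPowAlongOrbit.homologyMap_ev_injective {k : ℕ} {M : Type} [TopologicalSpace M]
    [MulAction (Torus k) M] [ContinuousSMul (Torus k) M] {f : C(M, Torus k)} {d : ℕ} {x : M}
    (hf : IsPowAlongOrbit f d x) (hd : d ≠ 0) (j : ℕ) :
    Function.Injective (homologyMap j (ev k x)) := by
  have hinj := homologyMap_torusPow_injective k hd j
  rw [← homologyMap_eq_of_homotopic j hf.comp_ev_homotopic, homologyMap_comp,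
    LinearMap.coe_comp] at hinj
  exact hinj.of_comp

theorem choose_le_betti_of_injective {k j : ℕ} {X : Type} [TopologicalSpace X]
    {f : C(Torus k, X)} (hf : Function.Injective (homologyMap j f)) :
    (k.choose j : Cardinal) ≤ betti j X := by
  rw [← betti_torus]
  exact LinearMap.rank_le_of_injective _ hf

end TorusAction

end

open TorusAction

theorem theorem2p2_general {E H : Type*} [NormedAddCommGroup E] [NormedSpace ℝ E]
    [FiniteDimensional ℝ E] [TopologicalSpace H] (I : ModelWithCorners ℝ E H) (k : ℕ) (M : Type)
    [TopologicalSpace M] [T2Space M] [ParacompactSpace M] [ConnectedSpace M] [ChartedSpace H M]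
    [IsManifold I 1 M] [MulAction (Torus k) M] [ContinuousSMul (Torus k) M]
    [ContMDiffSMul (torusModel k) I 1 (Torus k) M] (x₀ : M) (h : IsInjectiveSplitting k x₀) :
    (∀ (x : M) (j : ℕ), Function.Injective (homologyMap j (ev k x))) ∧
      (∀ j : ℕ, (k.choose j : Cardinal) ≤ betti j M) ∧
      (2 : Cardinal) ^ k ≤ ∑ j ∈ Finset.range (Module.finrank ℝ E + 1), betti j M ∧
      (∀ x : M, IsHomologicallyInjective k x) := by
  have := stronglyLocallyContractibleSpace_of_model I
  have := stronglyLocallyContractibleSpace_of_chartedSpace H M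
  have := PathConnectedSpace.of_locallyPathConnectedSpace (X := M)
  obtain ⟨d, hd, φ, hφ⟩ := h.exists_hom_evPi_eq_pow (winding k)
  obtain ⟨f, hf⟩ := exists_isPowAlongOrbit exists_mem_nhds_isSimplyConnected hφ
  have hinj (x : M) (j : ℕ) : Function.Injective (homologyMap j (ev k x)) := by
    rw [homologyMap_eq_of_homotopic j (ev_homotopic (PathConnectedSpace.somePath x x₀))]
    exact hf.homologyMap_ev_injective hd j
  have hbetti (j : ℕ) := choose_le_betti_of_injective (hinj x₀ j)
  exact ⟨hinj, hbetti, two_pow_le_sum_of_choose_le (hf.le_finrank I hd) hbetti, fun x => hinj x 1⟩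

theorem theorem2p2 (k n : ℕ) (M : Type) [TopologicalSpace M] [T2Space M] [CompactSpace M]
    [ConnectedSpace M] [ChartedSpace (EuclideanSpace ℝ (Fin n)) M] [IsManifold (𝓡 n) ∞ M]
    [MulAction (TorusAction.Torus k) M] [ContinuousSMul (TorusAction.Torus k) M]
    [ContMDiffSMul (TorusAction.torusModel k) (𝓡 n) ∞ (TorusAction.Torus k) M]
    (x₀ : M) (h : TorusAction.IsInjectiveSplitting k x₀) :
    (∀ (x : M) (j : ℕ),
        Function.Injective (TorusAction.homologyMap j (TorusAction.ev k x))) ∧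
      (∀ j : ℕ, (k.choose j : Cardinal) ≤ TorusAction.betti j M) ∧
      (2 : Cardinal) ^ k ≤ ∑ j ∈ Finset.range (n + 1), TorusAction.betti j M ∧
      (∀ x : M, TorusAction.IsHomologicallyInjective k x) := by
  simpa using theorem2p2_general (𝓡 n) k M x₀ h
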